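/- Let $\mathfrak g=\mathfrak g_0\oplus\mathfrak g_1$ be a finite-dimensional real $\mathbb Z_2$-graded semisimple Lie algebra, and let $\tau_{\mathfrak u}$ be a Cartan involution of $\mathfrak g$ that preserves the gradation, $\tau_{\mathfrak u}(\mathfrak g_i)=\mathfrak g_{-i}=\mathfrak g_i$ for $i\in\mathbb Z_2$ (an R-compatible Cartan involution), with Cartan decomposition $\mathfrak g=\mathfrak k\oplus\mathfrak p$, where $\mathfrak k$ is the fixed point set of $\tau_{\mathfrak u}$. Let $G$ be a connected Lie group with Lie algebra $\mathfrak g$, let $G_0$ be the connected Lie subgroup of $G$ with Lie algebra $\mathfrak g_0$, and let $K_0$ be the connected Lie subgroup of $G_0$ with Lie algebra $\mathfrak k\cap\mathfrak g_0$. Let $\mathfrak h_{st}\subset\mathfrak g_1$ be a standard Cartan subspace, i.e. a maximal subspace of $\mathfrak g_1$ consisting of commuting semisimple elements, with $\tau_{\mathfrak u}(\mathfrak h_{st})=\mathfrak h_{st}$. If $h,h'\in\mathfrak h_{st}$ are $Ad_{G_0}$-conjugate, then they are $Ad_{K_0}$-conjugate. -/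

import Mathlib

noncomputable section

namespace GradedLie

/-! ### The exponential of an endomorphism -/

section Exp

variable {V : Type*} [AddCommGroup V] [Module ℝ V]

/-- The exponential `∑ Tⁿ / n!` of an endomorphism of a finite-dimensional real vector space,
computed in the coordinates of a basis; it does not depend on the basis, see `expEnd_eq`. -/
def expEnd [FiniteDimensional ℝ V] (T : Module.End ℝ V) : Module.End ℝ V :=
  (LinearMap.toMatrixAlgEquiv (Module.finBasis ℝ V)).symm
    (NormedSpace.exp (LinearMap.toMatrixAlgEquiv (Module.finBasis ℝ V) T))

/-- The exponential may be computed in the coordinates of any basis. -/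
theorem expEnd_eq [FiniteDimensional ℝ V] {ι : Type*} [Fintype ι] [DecidableEq ι]
    (b : Module.Basis ι ℝ V) (T : Module.End ℝ V) :
    expEnd T = (LinearMap.toMatrixAlgEquiv b).symm
      (NormedSpace.exp (LinearMap.toMatrixAlgEquiv b T)) := by
  let f := (LinearMap.toMatrixAlgEquiv (Module.finBasis ℝ V)).symm.trans
    (LinearMap.toMatrixAlgEquiv b)
  have hf : Continuous f := LinearMap.continuous_of_finiteDimensional f.toLinearMap
  have key : ∀ A, f (NormedSpace.exp A) = NormedSpace.exp (f A) := by
    intro A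
    open scoped Matrix.Norms.Operator in exact NormedSpace.map_exp f hf A
  apply (LinearMap.toMatrixAlgEquiv b).injective
  have h := key (LinearMap.toMatrixAlgEquiv (Module.finBasis ℝ V) T)
  simp only [f, AlgEquiv.trans_apply, AlgEquiv.symm_apply_apply] at h
  rw [AlgEquiv.apply_symm_apply]
  exact h

/-- Every exponential is invertible, hence is an element of `GL(V)`. -/
theorem isUnit_expEnd [FiniteDimensional ℝ V] (T : Module.End ℝ V) : IsUnit (expEnd T) :=
  (Matrix.isUnit_exp _).map (LinearMap.toMatrixAlgEquiv (Module.finBasis ℝ V)).symm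

end Exp

section Lie

variable {𝔤 : Type*} [LieRing 𝔤] [LieAlgebra ℝ 𝔤]

/-- The image `Ad_S ⊆ GL(𝔤)` of the connected Lie subgroup `S` with Lie algebra `𝔰`, for a Lie
subalgebra `𝔰` of `𝔤`, under the adjoint representation on `𝔤`. A connected Lie group is generated
by the exponentials of its Lie algebra, and `Ad (exp x) = exp (ad x)`, so that `Ad_S` is the
subgroup of `GL(𝔤)` generated by all `exp (ad x)` with `x ∈ 𝔰`. -/
def adGroup [FiniteDimensional ℝ 𝔤] (𝔰 : LieSubalgebra ℝ 𝔤) :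
    Subgroup (LinearMap.GeneralLinearGroup ℝ 𝔤) :=
  Subgroup.closure
    {g | ∃ x ∈ 𝔰, (g : Module.End ℝ 𝔤) = expEnd (LieAlgebra.ad ℝ 𝔤 x)}

/-- Two elements of `𝔤` are `Ad_S`-conjugate, where `S` is the connected Lie subgroup with Lie
algebra `𝔰`. -/
def AdConj [FiniteDimensional ℝ 𝔤] (𝔰 : LieSubalgebra ℝ 𝔤) (x y : 𝔤) : Prop :=
  ∃ g ∈ adGroup 𝔰, (g : Module.End ℝ 𝔤) x = y

/-- The subalgebra `𝔤₀` of elements of degree zero in a `ℤ/m`-graded Lie algebra. -/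
def zeroPart {m : ℕ} (𝒢 : ZMod m → Submodule ℝ 𝔤) [GradedLieAlgebra 𝒢] : LieSubalgebra ℝ 𝔤 where
  toSubmodule := 𝒢 0
  lie_mem' {x y} hx hy := by
    have h : ⁅x, y⁆ ∈ 𝒢 (0 + 0) := SetLike.GradedBracket.bracket_mem hx hy
    rw [add_zero] at h
    exact h

/-- A Cartan involution: an involutive automorphism `τ` for which `-B(x, τ y)` is positive
definite, where `B` is the Killing form. -/
structure IsCartanInvolution (τ : 𝔤 ≃ₗ⁅ℝ⁆ 𝔤) : Prop where
  involutive : Function.Involutive τ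
  posDef : ∀ x : 𝔤, x ≠ 0 → 0 < -(killingForm ℝ 𝔤 x (τ x))

/-- `τ` is R-compatible with the gradation if it reverses it: `τ(𝔤 i) = 𝔤 (-i)`. -/
def IsRCompatible {m : ℕ} (𝒢 : ZMod m → Submodule ℝ 𝔤) (τ : 𝔤 ≃ₗ⁅ℝ⁆ 𝔤) : Prop :=
  ∀ i : ZMod m, (𝒢 i).map (τ : 𝔤 →ₗ[ℝ] 𝔤) = 𝒢 (-i)

/-- The subalgebra `𝔨` of fixed points of `τ`. If `τ` is a Cartan involution, it is the
`𝔨` of the Cartan decomposition `𝔤 = 𝔨 ⊕ 𝔭`. -/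
def fixedPart (τ : 𝔤 ≃ₗ⁅ℝ⁆ 𝔤) : LieSubalgebra ℝ 𝔤 where
  carrier := {x | τ x = x}
  add_mem' {x y} hx hy := by
    change τ (x + y) = x + y
    change τ x = x at hx
    change τ y = y at hy
    rw [map_add, hx, hy]
  zero_mem' := map_zero τ
  smul_mem' c x hx := by
    change τ (c • x) = c • x
    change τ x = x at hx
    rw [map_smul, hx]
  lie_mem' {x y} hx hy := by
    change τ ⁅x, y⁆ = ⁅x, y⁆
    change τ x = x at hx
    change τ y = y at hy
    rw [LieEquiv.map_lie, hx, hy]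

/-- An element is semisimple if its adjoint endomorphism is semisimple. -/
def IsSemisimpleElement (x : 𝔤) : Prop :=
  (LieAlgebra.ad ℝ 𝔤 x).IsSemisimple

/-- A Cartan subspace in `𝔤₁`: a maximal subspace of `𝔤₁` that consists of commuting semisimple
elements. -/
def IsCartanSubspace {m : ℕ} (𝒢 : ZMod m → Submodule ℝ 𝔤) (𝔥 : Submodule ℝ 𝔤) : Prop :=
  Maximal (fun 𝔞 : Submodule ℝ 𝔤 => 𝔞 ≤ 𝒢 1 ∧ (∀ x ∈ 𝔞, IsSemisimpleElement x) ∧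
    ∀ x ∈ 𝔞, ∀ y ∈ 𝔞, ⁅x, y⁆ = 0) 𝔥

/-- A standard Cartan subspace: a Cartan subspace in `𝔤₁` invariant under `τ`. -/
def IsStandardCartanSubspace {m : ℕ} (𝒢 : ZMod m → Submodule ℝ 𝔤) (τ : 𝔤 ≃ₗ⁅ℝ⁆ 𝔤)
    (𝔥 : Submodule ℝ 𝔤) : Prop :=
  IsCartanSubspace 𝒢 𝔥 ∧ ∀ x ∈ 𝔥, τ x ∈ 𝔥

end Lie

end GradedLie

end

/-!
For the inner product `-B(x, τ y)`, the adjoint of an automorphism `g` of `𝔤` is `τ g⁻¹ τ⁻¹`. Hence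
the group of the automorphisms that commute with a `τ`-stable set of endomorphisms is self-adjoint,
and its elements have a polar decomposition `g = k exp (ad p)` with `τ p = -p` and `k` commuting
with `τ`. As `k` depends continuously on `g`, it lies in the identity component if `g` does, and
these identity components are generated by exponentials. If the endomorphisms are the projections
onto the components of the gradation, then `g ∈ Ad_{G₀}` thus gives `k ∈ Ad_{K₀}`.

The elements `x` with `⁅x, τ x⁆ = 0`, such as those of `𝔥`, are the critical points of the norm on
their orbits. If `h` and `g h` are of this kind, then so is `exp (ad p) h = k⁻¹ g h`. The convex
function `t ↦ ‖exp (t ad p) h‖²` then has zero derivative at `0` and at `1`, which forces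
`exp (ad p) h = h`, hence `k h = g h`.
-/

noncomputable section

namespace GradedLie

open scoped Topology TensorProduct

section BanachAlgebra

variable {𝔸 : Type*} [NormedRing 𝔸] [NormedAlgebra ℝ 𝔸] [CompleteSpace 𝔸]

theorem hasStrictFDerivAt_exp_zero_equiv :
    HasStrictFDerivAt (NormedSpace.exp : 𝔸 → 𝔸) (ContinuousLinearEquiv.refl ℝ 𝔸 : 𝔸 →L[ℝ] 𝔸) 0 :=
  hasStrictFDerivAt_exp_zero

theorem map_exp_nhds_zero : Filter.map NormedSpace.exp (𝓝 (0 : 𝔸)) = 𝓝 1 := by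
  simpa only [NormedSpace.exp_zero] using
    (hasStrictFDerivAt_exp_zero_equiv (𝔸 := 𝔸)).map_nhds_eq_of_equiv

theorem exists_isOpen_injOn_exp :
    ∃ U : Set 𝔸, IsOpen U ∧ 0 ∈ U ∧ Set.InjOn NormedSpace.exp U :=
  let e := hasStrictFDerivAt_exp_zero_equiv.toOpenPartialHomeomorph (NormedSpace.exp : 𝔸 → 𝔸)
  ⟨e.source, e.open_source, hasStrictFDerivAt_exp_zero_equiv.mem_toOpenPartialHomeomorph_source,
    e.injOn⟩

/- If `x` commutes with `exp a`, then conjugation by the unit `u = 1 + ε x` near `1` moves `a`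
within the neighbourhood on which `exp` is injective and fixes `exp a`, hence it fixes `a`. -/
theorem eventually_commute_of_commute_exp :
    ∀ᶠ a in 𝓝 (0 : 𝔸), ∀ x, Commute x (NormedSpace.exp a) → Commute x a := by
  let _ := NormedAlgebra.restrictScalars ℚ ℝ 𝔸
  obtain ⟨U, hU, h0, hinj⟩ := exists_isOpen_injOn_exp (𝔸 := 𝔸)
  filter_upwards [hU.mem_nhds h0] with a ha x hx
  have htend : Filter.Tendsto (fun ε : ℝ => 1 + ε • x) (𝓝 0) (𝓝 ((1 : 𝔸ˣ) : 𝔸)) :=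
    (by fun_prop : Continuous fun ε : ℝ => 1 + ε • x).tendsto' _ _ (by simp)
  have hconj : Filter.Tendsto (fun ε : ℝ => (1 + ε • x) * a * Ring.inverse (1 + ε • x))
      (𝓝 0) (𝓝 a) := by
    simpa using (htend.mul_const a).mul ((NormedRing.inverse_continuousAt (1 : 𝔸ˣ)).tendsto.comp
      htend)
  have hnear : ∀ᶠ ε : ℝ in 𝓝[≠] 0,
      (1 + ε • x) * a * Ring.inverse (1 + ε • x) ∈ U ∧ IsUnit (1 + ε • x) :=
    nhdsWithin_le_nhds ((hconj.eventually_mem (hU.mem_nhds ha)).and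
      (htend.eventually (Units.nhds 1)))
  obtain ⟨ε, ⟨hεU, u, hu⟩, hε⟩ := (hnear.and self_mem_nhdsWithin).exists
  rw [← hu, Ring.inverse_unit] at hεU
  have hux : Commute (u : 𝔸) (NormedSpace.exp a) := by
    rw [hu]
    exact (Commute.one_left _).add_left (hx.smul_left ε)
  have hfix : u * a * ((u⁻¹ : 𝔸ˣ) : 𝔸) = a :=
    hinj hεU ha (by rw [NormedSpace.exp_units_conj, hux.eq, Units.mul_inv_cancel_right])
  have hua : Commute (u : 𝔸) a := (Units.mul_inv_eq_iff_eq_mul u).mp hfix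
  have hεx : ε • x = u - 1 := by rw [hu, add_sub_cancel_left]
  exact (Commute.smul_left_iff₀ hε).mp (hεx ▸ hua.sub_left (Commute.one_left a))

end BanachAlgebra

section

open scoped Matrix.Norms.Operator

variable (V : Type*) [AddCommGroup V] [Module ℝ V] [FiniteDimensional ℝ V]

/-- The algebra norm on `End V` given by the operator norm of matrices in a basis of `V`. It only
serves to make `End V` a Banach algebra, so the choice of the basis is irrelevant. -/
@[reducible] def endNormedRing : NormedRing (Module.End ℝ V) :=
  NormedRing.induced _ _ (LinearMap.toMatrixAlgEquiv (Module.finBasis ℝ V)).toRingHom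
    (LinearMap.toMatrixAlgEquiv (Module.finBasis ℝ V)).injective

attribute [local instance] endNormedRing

/-- `End V` as a real Banach algebra, with the norm of `endNormedRing`. -/
@[reducible] def endNormedAlgebra : NormedAlgebra ℝ (Module.End ℝ V) :=
  NormedAlgebra.induced ℝ _ _ (LinearMap.toMatrixAlgEquiv (Module.finBasis ℝ V)).toAlgHom

attribute [local instance] endNormedAlgebra

/-- `End V` as a rational Banach algebra, the structure over which Mathlib states the functional
equation of the exponential. -/
@[reducible] def endNormedAlgebraRat : NormedAlgebra ℚ (Module.End ℝ V) :=
  NormedAlgebra.restrictScalars ℚ ℝ _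

end

section Exponential

attribute [local instance] endNormedRing endNormedAlgebra endNormedAlgebraRat

variable {U V W : Type*} [AddCommGroup U] [Module ℝ U] [FiniteDimensional ℝ U]
  [AddCommGroup V] [Module ℝ V] [FiniteDimensional ℝ V]
  [AddCommGroup W] [Module ℝ W] [FiniteDimensional ℝ W]

theorem completeSpace_end : CompleteSpace (Module.End ℝ V) := FiniteDimensional.complete ℝ _

attribute [local instance] completeSpace_end

open scoped Matrix.Norms.Operator in
theorem expEnd_eq_exp : (expEnd : Module.End ℝ V → Module.End ℝ V) = NormedSpace.exp := by
  let f := (LinearMap.toMatrixAlgEquiv (Module.finBasis ℝ V)).symm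
  funext T
  calc expEnd T = NormedSpace.exp (f (f.symm T)) :=
        NormedSpace.map_exp f (LinearMap.continuous_of_finiteDimensional f.toLinearMap) _
    _ = NormedSpace.exp T := by rw [AlgEquiv.apply_symm_apply]

theorem continuous_expEnd : Continuous (expEnd : Module.End ℝ V → Module.End ℝ V) :=
  expEnd_eq_exp (V := V) ▸ NormedSpace.exp_continuous

theorem map_expEnd_nhds_zero : Filter.map expEnd (𝓝 (0 : Module.End ℝ V)) = 𝓝 1 :=
  expEnd_eq_exp (V := V) ▸ map_exp_nhds_zero

theorem expEnd_zero : expEnd (0 : Module.End ℝ V) = 1 := by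
  rw [expEnd_eq_exp, NormedSpace.exp_zero]

theorem expEnd_add_of_commute {S T : Module.End ℝ V} (h : Commute S T) :
    expEnd (S + T) = expEnd S * expEnd T := by
  simp only [expEnd_eq_exp, NormedSpace.exp_add_of_commute h]

theorem map_expEnd (f : Module.End ℝ V →ₐ[ℝ] Module.End ℝ W) (T : Module.End ℝ V) :
    f (expEnd T) = expEnd (f T) := by
  simp only [expEnd_eq_exp]
  exact NormedSpace.map_exp f (LinearMap.continuous_of_finiteDimensional f.toLinearMap) T

theorem map_expEnd_prod (f : Module.End ℝ V × Module.End ℝ W →ₐ[ℝ] Module.End ℝ U)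
    (A : Module.End ℝ V) (B : Module.End ℝ W) : f (expEnd A, expEnd B) = expEnd (f (A, B)) := by
  have hf : Continuous f := LinearMap.continuous_of_finiteDimensional f.toLinearMap
  have hAB : NormedSpace.exp (A, B) = (NormedSpace.exp A, NormedSpace.exp B) :=
    Prod.ext (Prod.fst_exp (A, B)) (Prod.snd_exp (A, B))
  simp only [expEnd_eq_exp, ← NormedSpace.map_exp f hf, hAB]

theorem eventually_commute_of_commute_expEnd (f : Module.End ℝ V →ₗ[ℝ] Module.End ℝ W) :
    ∀ᶠ T in 𝓝 0, ∀ S, Commute S (expEnd (f T)) → Commute S (f T) := by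
  have hf : Filter.Tendsto f (𝓝 0) (𝓝 0) :=
    (LinearMap.continuous_of_finiteDimensional f).tendsto' _ _ (map_zero f)
  simpa only [expEnd_eq_exp] using hf.eventually eventually_commute_of_commute_exp

theorem commute_expEnd_right {S T : Module.End ℝ V} (h : Commute S T) :
    Commute S (expEnd T) := by
  rw [expEnd_eq_exp]
  exact h.exp_right

theorem expEnd_prodMap (A : Module.End ℝ V) (B : Module.End ℝ W) :
    expEnd (A.prodMap B) = (expEnd A).prodMap (expEnd B) :=
  (map_expEnd_prod (LinearMap.prodMapAlgHom ℝ V W) A B).symm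

/-- The endomorphism `(v, w) ↦ (0, S v)`. Its commutant detects which block diagonal endomorphisms
are intertwined by `S`, which reduces statements on intertwiners to statements on commutants. -/
def offDiagonal (S : V →ₗ[ℝ] W) : Module.End ℝ (V × W) :=
  LinearMap.inr ℝ V W ∘ₗ S ∘ₗ LinearMap.fst ℝ V W

omit [FiniteDimensional ℝ V] [FiniteDimensional ℝ W] in
theorem commute_offDiagonal_prodMap_iff {S : V →ₗ[ℝ] W} {A : Module.End ℝ V}
    {B : Module.End ℝ W} :
    Commute (offDiagonal S) (A.prodMap B) ↔ B ∘ₗ S = S ∘ₗ A := by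
  simp [Commute, SemiconjBy, offDiagonal, LinearMap.ext_iff, eq_comm]

theorem expEnd_comp_of_comp_eq {S : V →ₗ[ℝ] W} {A : Module.End ℝ V} {B : Module.End ℝ W}
    (h : B ∘ₗ S = S ∘ₗ A) : expEnd B ∘ₗ S = S ∘ₗ expEnd A := by
  rw [← commute_offDiagonal_prodMap_iff] at h ⊢
  exact expEnd_prodMap A B ▸ commute_expEnd_right h

theorem eventually_comp_eq_of_expEnd_comp_eq (α : Module.End ℝ U →ₗ[ℝ] Module.End ℝ V)
    (β : Module.End ℝ U →ₗ[ℝ] Module.End ℝ W) :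
    ∀ᶠ T in 𝓝 0, ∀ S : V →ₗ[ℝ] W,
      expEnd (β T) ∘ₗ S = S ∘ₗ expEnd (α T) → β T ∘ₗ S = S ∘ₗ α T := by
  filter_upwards [eventually_commute_of_commute_expEnd
    ((LinearMap.prodMapAlgHom ℝ V W).toLinearMap ∘ₗ α.prod β)] with T hT S hS
  rw [← commute_offDiagonal_prodMap_iff] at hS ⊢
  exact hT _ ((expEnd_prodMap (α T) (β T)).symm ▸ hS)

theorem expEnd_apply_of_apply_eq_smul {T : Module.End ℝ V} {c : ℝ} {v : V} (h : T v = c • v) :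
    expEnd T v = Real.exp c • v := by
  have hc : expEnd (algebraMap ℝ (Module.End ℝ ℝ) c) = algebraMap ℝ _ (Real.exp c) := by
    rw [expEnd_eq_exp, Real.exp_eq_exp_ℝ, NormedSpace.algebraMap_exp_comm]
  have hS : T ∘ₗ LinearMap.toSpanSingleton ℝ V v =
      LinearMap.toSpanSingleton ℝ V v ∘ₗ algebraMap ℝ (Module.End ℝ ℝ) c := by
    ext
    simpa using h
  simpa [hc] using LinearMap.congr_fun (expEnd_comp_of_comp_eq hS) 1

section Diagonal

variable {ι κ : Type*} {u : Module.Basis ι ℝ V} {d : ι → ℝ} {A : Module.End ℝ V}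

omit [FiniteDimensional ℝ V] in
theorem repr_apply_of_apply_basis (hA : ∀ i, A (u i) = d i • u i) (v : V) (i : ι) :
    u.repr (A v) i = d i * u.repr v i := by
  have hcoord : u.coord i ∘ₗ A = d i • u.coord i := u.ext fun j => by
    by_cases hij : j = i <;> simp [hA, hij]
  exact LinearMap.congr_fun hcoord v

theorem apply_eq_smul_of_expEnd_apply (hA : ∀ i, A (u i) = d i • u i) {c : ℝ} {v : V}
    (h : expEnd A v = Real.exp c • v) : A v = c • v := by
  refine u.ext_elem fun i => ?_
  have hi := repr_apply_of_apply_basis (fun i => expEnd_apply_of_apply_eq_smul (hA i)) v i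
  rw [h, map_smul, Finsupp.smul_apply, smul_eq_mul] at hi
  rw [repr_apply_of_apply_basis hA, map_smul, Finsupp.smul_apply, smul_eq_mul]
  by_cases hv : u.repr v i = 0
  · simp only [hv, mul_zero]
  · rw [Real.exp_injective (mul_right_cancel₀ hv hi)]

theorem comp_eq_of_expEnd_comp_eq (hA : ∀ i, A (u i) = d i • u i) {B : Module.End ℝ W}
    {w : Module.Basis κ ℝ W} {e : κ → ℝ} (hB : ∀ j, B (w j) = e j • w j) {S : V →ₗ[ℝ] W}
    (h : expEnd B ∘ₗ S = S ∘ₗ expEnd A) : B ∘ₗ S = S ∘ₗ A := by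
  refine u.ext fun i => ?_
  have hi : expEnd B (S (u i)) = Real.exp (d i) • S (u i) := by
    rw [← LinearMap.comp_apply, h, LinearMap.comp_apply,
      expEnd_apply_of_apply_eq_smul (hA i), map_smul]
  rw [LinearMap.comp_apply, LinearMap.comp_apply, hA, map_smul,
    apply_eq_smul_of_expEnd_apply hB hi]

end Diagonal

end Exponential

section KroneckerSum

variable {V : Type*} [AddCommGroup V] [Module ℝ V]

/-- The endomorphism `T ⊗ 1 + 1 ⊗ T` of `V ⊗ V`. A linear map `V ⊗ V → V`, regarded as a product
on `V`, intertwines it with `T` if and only if `T` is a derivation of this product. -/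
def kroneckerSum : Module.End ℝ V →ₗ[ℝ] Module.End ℝ (V ⊗[ℝ] V) :=
  LinearMap.rTensorHom V + LinearMap.lTensorHom V

theorem kroneckerSum_tmul (T : Module.End ℝ V) (x y : V) :
    kroneckerSum T (x ⊗ₜ y) = T x ⊗ₜ y + x ⊗ₜ T y := rfl

theorem expEnd_kroneckerSum [FiniteDimensional ℝ V] (T : Module.End ℝ V) :
    expEnd (kroneckerSum T) = TensorProduct.map (expEnd T) (expEnd T) := by
  have hcomm : Commute (T.rTensor V) (T.lTensor V) :=
    (LinearMap.rTensor_comp_lTensor V T T).trans (LinearMap.lTensor_comp_rTensor V T T).symm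
  calc expEnd (kroneckerSum T) = expEnd (T.rTensor V) * expEnd (T.lTensor V) :=
        expEnd_add_of_commute hcomm
    _ = (expEnd T).rTensor V * (expEnd T).lTensor V :=
        congr_arg₂ (· * ·) (map_expEnd (Module.End.rTensorAlgHom ℝ V V) T).symm
          (map_expEnd (Module.End.lTensorAlgHom ℝ V V) T).symm
    _ = TensorProduct.map (expEnd T) (expEnd T) := LinearMap.rTensor_comp_lTensor V _ _

theorem kroneckerSum_basis {ι : Type*} {u : Module.Basis ι ℝ V} {d : ι → ℝ}
    {T : Module.End ℝ V} (hT : ∀ i, T (u i) = d i • u i) (p : ι × ι) :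
    kroneckerSum T (u.tensorProduct u p) = (d p.1 + d p.2) • u.tensorProduct u p := by
  rw [Module.Basis.tensorProduct_apply', kroneckerSum_tmul, hT, hT, ← TensorProduct.smul_tmul',
    TensorProduct.tmul_smul, add_smul]

end KroneckerSum

section Automorphism

variable {𝔤 : Type*} [LieRing 𝔤] [LieAlgebra ℝ 𝔤]

/-- The bracket of `𝔤` as a linear map on the tensor product. -/
def bracketMap : 𝔤 ⊗[ℝ] 𝔤 →ₗ[ℝ] 𝔤 := LieModule.toModuleHom ℝ 𝔤 𝔤

theorem bracketMap_tmul (x y : 𝔤) : bracketMap (x ⊗ₜ[ℝ] y) = ⁅x, y⁆ :=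
  LieModule.toModuleHom_apply ℝ 𝔤 𝔤 x y

theorem comp_bracketMap_iff_derivation {T : Module.End ℝ 𝔤} :
    T ∘ₗ bracketMap = bracketMap ∘ₗ kroneckerSum T ↔
      ∀ x y, T ⁅x, y⁆ = ⁅T x, y⁆ + ⁅x, T y⁆ := by
  refine ⟨fun h x y => ?_, fun h => TensorProduct.ext' fun x y => ?_⟩
  · simpa [bracketMap_tmul, kroneckerSum_tmul] using LinearMap.congr_fun h (x ⊗ₜ y)
  · simpa [bracketMap_tmul, kroneckerSum_tmul] using h x y

theorem comp_bracketMap_iff_automorphism {T : Module.End ℝ 𝔤} :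
    T ∘ₗ bracketMap = bracketMap ∘ₗ TensorProduct.map T T ↔ ∀ x y, T ⁅x, y⁆ = ⁅T x, T y⁆ := by
  refine ⟨fun h x y => ?_, fun h => TensorProduct.ext' fun x y => ?_⟩
  · simpa [bracketMap_tmul] using LinearMap.congr_fun h (x ⊗ₜ y)
  · simpa [bracketMap_tmul] using h x y

theorem exists_ad_eq_of_derivation [FiniteDimensional ℝ 𝔤] [LieAlgebra.IsKilling ℝ 𝔤]
    {T : Module.End ℝ 𝔤} (hT : ∀ x y, T ⁅x, y⁆ = ⁅T x, y⁆ + ⁅x, T y⁆) :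
    ∃ x, LieAlgebra.ad ℝ 𝔤 x = T := by
  obtain ⟨x, hx⟩ := LieDerivation.IsKilling.exists_eq_ad
    (⟨T, fun x y => by rw [hT, ← lie_skew y (T x), sub_neg_eq_add, add_comm]⟩ : LieDerivation ℝ 𝔤 𝔤)
  exact ⟨x, LinearMap.ext fun y => by
    rw [LieAlgebra.ad_apply, ← LieDerivation.ad_apply_apply ℝ, hx]
    rfl⟩

/-- The group of automorphisms of `𝔤` that commute with all members of `C`. -/
def autCentralizer (C : Set (Module.End ℝ 𝔤)) : Subgroup (LinearMap.GeneralLinearGroup ℝ 𝔤) where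
  carrier := {g | (∀ x y, (g : Module.End ℝ 𝔤) ⁅x, y⁆ = ⁅(g : Module.End ℝ 𝔤) x,
    (g : Module.End ℝ 𝔤) y⁆) ∧ ∀ c ∈ C, Commute (g : Module.End ℝ 𝔤) c}
  mul_mem' {g k} hg hk := ⟨fun x y => by simp [hk.1, hg.1], fun c hc =>
    (hg.2 c hc).mul_left (hk.2 c hc)⟩
  one_mem' := ⟨fun _ _ => rfl, fun c _ => Commute.one_left c⟩
  inv_mem' {g} hg := by
    refine ⟨fun x y => ?_, fun c hc => (hg.2 c hc).units_inv_left⟩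
    have hinj : Function.Injective (g : Module.End ℝ 𝔤) :=
      (LinearMap.GeneralLinearGroup.generalLinearEquiv ℝ 𝔤 g).injective
    have hinv (x : 𝔤) : (g : Module.End ℝ 𝔤) ((g⁻¹ : LinearMap.GeneralLinearGroup ℝ 𝔤).1 x) = x :=
      LinearMap.congr_fun g.mul_inv x
    exact hinj (by rw [hinv, hg.1, hinv, hinv])

/-- The subalgebra of the elements of `𝔤` whose adjoint endomorphisms commute with all members
of `C`. -/
def lieCentralizer (C : Set (Module.End ℝ 𝔤)) : LieSubalgebra ℝ 𝔤 where
  carrier := {x | ∀ c ∈ C, Commute (LieAlgebra.ad ℝ 𝔤 x) c}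
  add_mem' hx hy c hc := by
    rw [map_add]
    exact (hx c hc).add_left (hy c hc)
  zero_mem' c _ := by
    rw [map_zero]
    exact Commute.zero_left c
  smul_mem' r x hx c hc := by
    rw [map_smul]
    exact (hx c hc).smul_left r
  lie_mem' {x y} hx hy c hc := by
    have hlie : LieAlgebra.ad ℝ 𝔤 ⁅x, y⁆ =
        LieAlgebra.ad ℝ 𝔤 x * LieAlgebra.ad ℝ 𝔤 y - LieAlgebra.ad ℝ 𝔤 y * LieAlgebra.ad ℝ 𝔤 x :=
      LinearMap.ext fun z => lie_lie x y z
    rw [hlie]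
    exact ((hx c hc).mul_left (hy c hc)).sub_left ((hy c hc).mul_left (hx c hc))

theorem mem_autCentralizer_insert_iff {C : Set (Module.End ℝ 𝔤)} {c : Module.End ℝ 𝔤}
    {g : LinearMap.GeneralLinearGroup ℝ 𝔤} :
    g ∈ autCentralizer (insert c C) ↔ Commute (g : Module.End ℝ 𝔤) c ∧ g ∈ autCentralizer C := by
  simp [autCentralizer, and_left_comm]

end Automorphism

section AdjointGroup

variable {𝔤 : Type*} [LieRing 𝔤] [LieAlgebra ℝ 𝔤] [FiniteDimensional ℝ 𝔤]
  {C : Set (Module.End ℝ 𝔤)}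

/-- The automorphism `exp (ad x)` of `𝔤` as an element of `GL(𝔤)`. -/
def expAd (x : 𝔤) : LinearMap.GeneralLinearGroup ℝ 𝔤 :=
  (isUnit_expEnd (LieAlgebra.ad ℝ 𝔤 x)).unit

theorem val_expAd (x : 𝔤) : (expAd x : Module.End ℝ 𝔤) = expEnd (LieAlgebra.ad ℝ 𝔤 x) := rfl

theorem expAd_zero : expAd (0 : 𝔤) = 1 :=
  Units.ext (by rw [val_expAd, map_zero, expEnd_zero, Units.val_one])

theorem expAd_add_of_lie_eq_zero {x y : 𝔤} (h : ⁅x, y⁆ = 0) :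
    expAd (x + y) = expAd x * expAd y := by
  have hcomm : Commute (LieAlgebra.ad ℝ 𝔤 x) (LieAlgebra.ad ℝ 𝔤 y) :=
    LinearMap.ext fun z => sub_eq_zero.mp (by simpa [h] using (lie_lie x y z).symm)
  exact Units.ext (by rw [val_expAd, map_add, expEnd_add_of_commute hcomm, Units.val_mul,
    val_expAd, val_expAd])

theorem expAd_neg (x : 𝔤) : expAd (-x) = (expAd x)⁻¹ := by
  have h : ⁅-x, x⁆ = 0 := by rw [neg_lie, lie_self, neg_zero]
  rw [eq_inv_iff_mul_eq_one, ← expAd_add_of_lie_eq_zero h, neg_add_cancel, expAd_zero]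

theorem expAd_mem_adGroup {𝔰 : LieSubalgebra ℝ 𝔤} {x : 𝔤} (hx : x ∈ 𝔰) : expAd x ∈ adGroup 𝔰 :=
  Subgroup.subset_closure ⟨x, hx, rfl⟩

theorem adGroup_le_iff {𝔰 : LieSubalgebra ℝ 𝔤} {H : Subgroup (LinearMap.GeneralLinearGroup ℝ 𝔤)} :
    adGroup 𝔰 ≤ H ↔ ∀ x ∈ 𝔰, expAd x ∈ H := by
  refine ⟨fun h x hx => h (expAd_mem_adGroup hx), fun h => (Subgroup.closure_le H).mpr ?_⟩
  rintro g ⟨x, hx, hg⟩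
  rw [show g = expAd x from Units.ext hg]
  exact h x hx

theorem expAd_mem_autCentralizer {x : 𝔤} (hx : x ∈ lieCentralizer C) :
    expAd x ∈ autCentralizer C := by
  refine ⟨comp_bracketMap_iff_automorphism.mp ?_, fun c hc => ?_⟩
  · rw [val_expAd, ← expEnd_kroneckerSum]
    exact expEnd_comp_of_comp_eq (comp_bracketMap_iff_derivation.mpr (leibniz_lie x))
  · exact (commute_expEnd_right (hx c hc).symm).symm

theorem adGroup_le_autCentralizer : adGroup (lieCentralizer C) ≤ autCentralizer C :=
  adGroup_le_iff.mpr fun _ hx => expAd_mem_autCentralizer hx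

section Logarithm

variable [LieAlgebra.IsKilling ℝ 𝔤] {g : LinearMap.GeneralLinearGroup ℝ 𝔤}

theorem exists_mem_lieCentralizer_ad_eq {T : Module.End ℝ 𝔤}
    (hT : T ∘ₗ bracketMap = bracketMap ∘ₗ kroneckerSum T) (hC : ∀ c ∈ C, Commute T c) :
    ∃ x ∈ lieCentralizer C, LieAlgebra.ad ℝ 𝔤 x = T := by
  obtain ⟨x, rfl⟩ := exists_ad_eq_of_derivation (comp_bracketMap_iff_derivation.mp hT)
  exact ⟨x, hC, rfl⟩

theorem exists_mem_lieCentralizer_expAd_eq (hg : g ∈ autCentralizer C)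
    {ι : Type*} {u : Module.Basis ι ℝ 𝔤} {d : ι → ℝ} {T : Module.End ℝ 𝔤}
    (hT : ∀ i, T (u i) = d i • u i) (hgT : (g : Module.End ℝ 𝔤) = expEnd T) :
    ∃ x ∈ lieCentralizer C, LieAlgebra.ad ℝ 𝔤 x = T := by
  refine exists_mem_lieCentralizer_ad_eq ?_ fun c hc => ?_
  · refine comp_eq_of_expEnd_comp_eq (kroneckerSum_basis hT) hT ?_
    rw [expEnd_kroneckerSum, ← hgT]
    exact comp_bracketMap_iff_automorphism.mpr hg.1
  · refine comp_eq_of_expEnd_comp_eq hT hT ?_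
    rw [← hgT]
    exact hg.2 c hc

attribute [local instance] endNormedRing endNormedAlgebra

theorem eventually_exists_mem_lieCentralizer_ad_eq :
    ∀ᶠ T in 𝓝 (0 : Module.End ℝ 𝔤), ∀ g ∈ autCentralizer C, (g : Module.End ℝ 𝔤) = expEnd T →
      ∃ x ∈ lieCentralizer C, LieAlgebra.ad ℝ 𝔤 x = T := by
  filter_upwards [eventually_comp_eq_of_expEnd_comp_eq kroneckerSum LinearMap.id,
    eventually_comp_eq_of_expEnd_comp_eq LinearMap.id LinearMap.id] with T hder hcomm g hg hgT
  refine exists_mem_lieCentralizer_ad_eq (hder _ ?_) fun c hc => hcomm c ?_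
  · rw [expEnd_kroneckerSum, LinearMap.id_apply, ← hgT]
    exact comp_bracketMap_iff_automorphism.mpr hg.1
  · rw [LinearMap.id_apply, ← hgT]
    exact hg.2 c hc

theorem isOpen_adGroup_subgroupOf_autCentralizer :
    IsOpen ((adGroup (lieCentralizer C)).subgroupOf (autCentralizer C) :
      Set (autCentralizer C)) := by
  have hlog : ∀ᶠ A in 𝓝 (1 : Module.End ℝ 𝔤), ∀ g ∈ autCentralizer C, (g : Module.End ℝ 𝔤) = A →
      g ∈ adGroup (lieCentralizer C) := by
    rw [← map_expEnd_nhds_zero, Filter.eventually_map]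
    filter_upwards [eventually_exists_mem_lieCentralizer_ad_eq (C := C)] with T hT g hg hgT
    obtain ⟨x, hx, rfl⟩ := hT g hg hgT
    exact Subgroup.subset_closure ⟨x, hx, hgT⟩
  have hval : Continuous fun g : autCentralizer C => (g.1 : Module.End ℝ 𝔤) :=
    Units.continuous_val.comp continuous_subtype_val
  refine Subgroup.isOpen_of_mem_nhds _ (g := 1) ?_
  filter_upwards [(hval.tendsto' 1 1 rfl).eventually hlog] with g hg
  exact Subgroup.mem_subgroupOf.mpr (hg g g.2 rfl)

end Logarithm

section Component

attribute [local instance] endNormedRing endNormedAlgebra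

theorem continuous_expAd_smul (x : 𝔤) : Continuous fun t : ℝ => expAd (t • x) := by
  have hval (y : 𝔤) : Continuous fun t : ℝ => expEnd (LieAlgebra.ad ℝ 𝔤 (t • y)) := by
    simp only [map_smul]
    exact continuous_expEnd.comp (continuous_id.smul continuous_const)
  refine Units.continuous_iff.mpr ⟨hval x, ?_⟩
  exact (hval (-x)).congr fun t => by rw [smul_neg, ← val_expAd, expAd_neg]

theorem adGroup_le_connectedComponent :
    adGroup (lieCentralizer C) ≤
      (Subgroup.connectedComponentOfOne (autCentralizer C)).map (autCentralizer C).subtype := by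
  refine adGroup_le_iff.mpr fun x hx => ?_
  let γ (t : ℝ) : autCentralizer C :=
    ⟨expAd (t • x), expAd_mem_autCentralizer ((lieCentralizer C).smul_mem t hx)⟩
  have hγ : Continuous γ := (continuous_expAd_smul x).subtype_mk _
  have hγ0 : γ 0 = 1 := Subtype.ext (by simp only [γ, zero_smul, expAd_zero, OneMemClass.coe_one])
  refine ⟨γ 1, ?_, by simp only [γ, one_smul, Subgroup.subtype_apply]⟩
  exact (isPreconnected_range hγ).subset_connectedComponent ⟨0, hγ0⟩ ⟨1, rfl⟩

theorem adGroup_eq_connectedComponent [LieAlgebra.IsKilling ℝ 𝔤] :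
    adGroup (lieCentralizer C) =
      (Subgroup.connectedComponentOfOne (autCentralizer C)).map (autCentralizer C).subtype := by
  refine adGroup_le_connectedComponent.antisymm ?_
  let H := (adGroup (lieCentralizer C)).subgroupOf (autCentralizer C)
  have hopen : IsOpen (H : Set (autCentralizer C)) := isOpen_adGroup_subgroupOf_autCentralizer
  have hclopen : IsClopen (H : Set (autCentralizer C)) :=
    ⟨Subgroup.isClosed_of_isOpen H hopen, hopen⟩
  rintro - ⟨g, hg, rfl⟩
  exact hclopen.connectedComponent_subset (one_mem H) hg

end Component

end AdjointGroup

section PositiveDefiniteForm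

variable {V : Type*} [AddCommGroup V] [Module ℝ V] [FiniteDimensional ℝ V]
  {Q : LinearMap.BilinForm ℝ V} {T : Module.End ℝ V}

theorem exists_orthonormal_eigenbasis (hsymm : Q.IsSymm) (hpos : ∀ x, x ≠ 0 → 0 < Q x x)
    (hT : Q.IsSelfAdjoint T) :
    ∃ (u : Module.Basis (Fin (Module.finrank ℝ V)) ℝ V) (d : Fin (Module.finrank ℝ V) → ℝ),
      (∀ i j, Q (u i) (u j) = if i = j then 1 else 0) ∧ ∀ i, T (u i) = d i • u i := by
  let core : InnerProductSpace.Core ℝ V :=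
    { inner x y := Q x y
      conj_inner_symm x y := hsymm.eq y x
      re_inner_nonneg x := by
        rcases eq_or_ne x 0 with rfl | hx
        · simp
        · exact (hpos x hx).le
      add_left x y z := LinearMap.BilinForm.add_left x y z
      smul_left x y r := LinearMap.BilinForm.smul_left r x y
      definite x hx := by_contra fun h => (hpos x h).ne' hx }
  let := core.toNormedAddCommGroup
  let := InnerProductSpace.ofCore core.toCore
  have hTsymm : T.IsSymmetric := hT
  have hu := (hTsymm.eigenvectorBasis rfl).orthonormal
  refine ⟨(hTsymm.eigenvectorBasis rfl).toBasis, hTsymm.eigenvalues rfl, fun i j => ?_, fun i => ?_⟩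
  · rw [OrthonormalBasis.coe_toBasis]
    exact orthonormal_iff_ite.mp hu i j
  · rw [OrthonormalBasis.coe_toBasis]
    exact hTsymm.apply_eigenvectorBasis rfl i

omit [FiniteDimensional ℝ V] in
theorem form_apply_eq_sum_repr {ι : Type*} [Fintype ι] [DecidableEq ι] {u : Module.Basis ι ℝ V}
    (hu : ∀ i j, Q (u i) (u j) = if i = j then 1 else 0) (v w : V) :
    Q v w = ∑ i, u.repr v i * u.repr w i := by
  calc Q v w = Q (∑ i, u.repr v i • u i) (∑ j, u.repr w j • u j) := by simp only [u.sum_repr]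
    _ = ∑ i, u.repr v i * u.repr w i := by
      simp only [map_sum, map_smul, LinearMap.sum_apply, LinearMap.smul_apply, hu]
      simp [mul_comm]

-- Up to a factor `2`, the two sides of `h` are the derivatives at `1` and `0` of the convex
-- function `t ↦ Q (expEnd (t • T) v) (expEnd (t • T) v)`.
theorem expEnd_apply_eq_self_of_form_eq (hsymm : Q.IsSymm) (hpos : ∀ x, x ≠ 0 → 0 < Q x x)
    (hT : Q.IsSelfAdjoint T) {v : V}
    (h : Q (T (expEnd T v)) (expEnd T v) = Q (T v) v) : expEnd T v = v := by
  obtain ⟨u, d, hu, hd⟩ := exists_orthonormal_eigenbasis hsymm hpos hT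
  have hexp := repr_apply_of_apply_basis fun i => expEnd_apply_of_apply_eq_smul (hd i)
  have hsum : ∑ i, d i * (Real.exp (d i) ^ 2 - 1) * u.repr v i ^ 2 = 0 := by
    simp only [form_apply_eq_sum_repr hu, repr_apply_of_apply_basis hd, hexp] at h
    rw [← sub_eq_zero, ← Finset.sum_sub_distrib] at h
    rw [← h]
    exact Finset.sum_congr rfl fun i _ => by ring
  have hnonneg (c : ℝ) : 0 ≤ c * (Real.exp c ^ 2 - 1) := by
    rcases le_total 0 c with hc | hc
    · exact mul_nonneg hc (sub_nonneg.mpr (one_le_pow₀ (Real.one_le_exp hc)))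
    · exact mul_nonneg_of_nonpos_of_nonpos hc
        (sub_nonpos.mpr (pow_le_one₀ (Real.exp_pos c).le (Real.exp_le_one_iff.mpr hc)))
  have hterm := (Finset.sum_eq_zero_iff_of_nonneg fun i _ =>
    mul_nonneg (hnonneg (d i)) (sq_nonneg _)).mp hsum
  refine u.ext_elem fun i => ?_
  rw [hexp]
  rcases mul_eq_zero.mp (hterm i (Finset.mem_univ i)) with hi | hi
  · have hi' : Real.exp (d i) = 1 := by
      rcases mul_eq_zero.mp hi with hi | hi
      · rw [hi, Real.exp_zero]
      · exact (pow_eq_one_iff_of_nonneg (Real.exp_pos _).le two_ne_zero).mp (sub_eq_zero.mp hi)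
    rw [hi', one_mul]
  · rw [pow_eq_zero_iff two_ne_zero |>.mp hi, mul_zero]

theorem exists_eq_expEnd_of_form_pos (hsymm : Q.IsSymm) (hpos : ∀ x, x ≠ 0 → 0 < Q x x)
    (hT : Q.IsSelfAdjoint T) (hTpos : ∀ x, x ≠ 0 → 0 < Q (T x) x) :
    ∃ (u : Module.Basis (Fin (Module.finrank ℝ V)) ℝ V) (d : Fin (Module.finrank ℝ V) → ℝ)
      (D : Module.End ℝ V), (∀ i, D (u i) = d i • u i) ∧ T = expEnd D := by
  obtain ⟨u, d, hu, hd⟩ := exists_orthonormal_eigenbasis hsymm hpos hT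
  have hdpos (i) : 0 < d i := by simpa [hd, hu] using hTpos (u i) (u.ne_zero i)
  have hlog (i) : u.constr ℝ (fun i => Real.log (d i) • u i) (u i) = Real.log (d i) • u i :=
    u.constr_basis ℝ _ i
  refine ⟨u, fun i => Real.log (d i), _, hlog, u.ext fun i => ?_⟩
  rw [expEnd_apply_of_apply_eq_smul (hlog i), Real.exp_log (hdpos i), hd]

open scoped Matrix MatrixOrder

omit [FiniteDimensional ℝ V] in
theorem toMatrixAlgEquiv_nonneg {ι : Type*} [Fintype ι] [DecidableEq ι] {u : Module.Basis ι ℝ V}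
    (hu : ∀ i j, Q (u i) (u j) = if i = j then 1 else 0) (hsymm : Q.IsSymm)
    (hT : Q.IsSelfAdjoint T) (hnonneg : ∀ x, 0 ≤ Q (T x) x) :
    0 ≤ LinearMap.toMatrixAlgEquiv u T := by
  have hentry (i j) : LinearMap.toMatrixAlgEquiv u T i j = Q (T (u j)) (u i) := by
    simp [form_apply_eq_sum_repr hu, LinearMap.toMatrixAlgEquiv_apply, Finsupp.single_apply]
  refine Matrix.nonneg_iff_posSemidef.mpr (Matrix.posSemidef_iff_dotProduct_mulVec.mpr
    ⟨Matrix.IsHermitian.ext fun i j => ?_, fun w => ?_⟩)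
  · rw [star_trivial, hentry, hentry, hT, hsymm.eq]
  · obtain ⟨x, rfl⟩ := u.equivFun.surjective w
    calc 0 ≤ Q (T x) x := hnonneg x
      _ = u.equivFun (T x) ⬝ᵥ u.equivFun x := form_apply_eq_sum_repr hu _ _
      _ = star (u.equivFun x) ⬝ᵥ LinearMap.toMatrixAlgEquiv u T *ᵥ u.equivFun x := by
        rw [star_trivial, dotProduct_comm]
        exact congrArg _ (LinearMap.toMatrix_mulVec_repr u u T x).symm

attribute [local instance] endNormedRing endNormedAlgebra

open scoped Matrix.Norms.L2Operator in
theorem continuous_of_continuous_mul_self (hsymm : Q.IsSymm) (hpos : ∀ x, x ≠ 0 → 0 < Q x x)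
    {X : Type*} [TopologicalSpace X] {S : X → Module.End ℝ V} (hS : ∀ x, Q.IsSelfAdjoint (S x))
    (hnonneg : ∀ x v, 0 ≤ Q (S x v) v) (hcont : Continuous fun x => S x * S x) :
    Continuous S := by
  obtain ⟨u, -, hu, -⟩ := exists_orthonormal_eigenbasis (T := 0) hsymm hpos fun _ _ => by simp
  let f := LinearMap.toMatrixAlgEquiv u
  have hf : Continuous f := LinearMap.continuous_of_finiteDimensional f.toLinearMap
  have hf' : Continuous f.symm := LinearMap.continuous_of_finiteDimensional f.symm.toLinearMap
  have hfS (x) : 0 ≤ f (S x) := toMatrixAlgEquiv_nonneg hu hsymm (hS x) (hnonneg x)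
  have hmul : Continuous fun x => f (S x) * f (S x) :=
    (hf.comp hcont).congr fun x => map_mul f (S x) (S x)
  have hsqrt : Continuous fun x => CFC.sqrt (f (S x) * f (S x)) :=
    CFC.continuousOn_sqrt.comp_continuous hmul fun x =>
      (IsSelfAdjoint.of_nonneg (hfS x)).mul_self_nonneg
  exact (hf'.comp hsqrt).congr fun x => by
    rw [Function.comp_apply, CFC.sqrt_mul_self _ (hfS x), AlgEquiv.symm_apply_apply]

end PositiveDefiniteForm

section CartanInvolution

variable {𝔤 : Type*} [LieRing 𝔤] [LieAlgebra ℝ 𝔤]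
  {C : Set (Module.End ℝ 𝔤)} {τ : 𝔤 ≃ₗ⁅ℝ⁆ 𝔤} {g : LinearMap.GeneralLinearGroup ℝ 𝔤} {p : 𝔤}

/-- The form `-B(x, τ y)` for the Killing form `B`. It is an inner product on `𝔤` if `τ` is a
Cartan involution. -/
def cartanForm (τ : 𝔤 ≃ₗ⁅ℝ⁆ 𝔤) : LinearMap.BilinForm ℝ 𝔤 :=
  -(killingForm ℝ 𝔤).compl₂ (τ : 𝔤 →ₗ[ℝ] 𝔤)

theorem cartanForm_apply (x y : 𝔤) : cartanForm τ x y = -killingForm ℝ 𝔤 x (τ y) := rfl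

theorem IsCartanInvolution.cartanForm_comm (hτ : IsCartanInvolution τ) (x y : 𝔤) :
    cartanForm τ x y = cartanForm τ y x := by
  rw [cartanForm_apply, cartanForm_apply, ← LieAlgebra.killingForm_of_equiv_apply τ,
    hτ.involutive, LieModule.traceForm_comm]

theorem IsCartanInvolution.isSymm_cartanForm (hτ : IsCartanInvolution τ) :
    (cartanForm τ).IsSymm :=
  ⟨hτ.cartanForm_comm⟩

theorem IsCartanInvolution.cartanForm_pos (hτ : IsCartanInvolution τ) (x : 𝔤) (hx : x ≠ 0) :
    0 < cartanForm τ x x :=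
  hτ.posDef x hx

theorem IsCartanInvolution.cartanForm_nonneg (hτ : IsCartanInvolution τ) (x : 𝔤) :
    0 ≤ cartanForm τ x x := by
  rcases eq_or_ne x 0 with rfl | hx
  · rw [map_zero]
  · exact (hτ.posDef x hx).le

theorem IsCartanInvolution.isKilling (hτ : IsCartanInvolution τ) : LieAlgebra.IsKilling ℝ 𝔤 where
  killingCompl_top_eq_bot := by
    refine (LieSubmodule.eq_bot_iff _).mpr fun x hx => by_contra fun hx0 => ?_
    rw [LieIdeal.mem_killingCompl] at hx
    have hpos := hτ.posDef x hx0
    rw [LieModule.traceForm_comm, hx _ (LieSubmodule.mem_top _), neg_zero] at hpos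
    exact lt_irrefl _ hpos

theorem isSelfAdjoint_ad_of_map_eq_neg (hp : τ p = -p) :
    (cartanForm τ).IsSelfAdjoint (LieAlgebra.ad ℝ 𝔤 p) := fun x y => by
  rw [cartanForm_apply, cartanForm_apply, LieAlgebra.ad_apply, LieAlgebra.ad_apply,
    LieEquiv.map_lie, hp, ← lie_skew, map_neg, LinearMap.neg_apply,
    LieModule.traceForm_apply_lie_apply, neg_lie, map_neg]

/-- An automorphism of `𝔤` as an element of `GL(𝔤)`. -/
def toGL (φ : 𝔤 ≃ₗ⁅ℝ⁆ 𝔤) : LinearMap.GeneralLinearGroup ℝ 𝔤 :=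
  LinearMap.GeneralLinearGroup.ofLinearEquiv φ.toLinearEquiv

theorem toGL_apply (φ : 𝔤 ≃ₗ⁅ℝ⁆ 𝔤) (x : 𝔤) : (toGL φ : Module.End ℝ 𝔤) x = φ x := rfl

theorem IsCartanInvolution.toGL_mul_self (hτ : IsCartanInvolution τ) : toGL τ * toGL τ = 1 :=
  Units.ext (LinearMap.ext hτ.involutive)

theorem IsCartanInvolution.inv_toGL (hτ : IsCartanInvolution τ) : (toGL τ)⁻¹ = toGL τ :=
  inv_eq_of_mul_eq_one_left hτ.toGL_mul_self

theorem IsCartanInvolution.toGL_mul_toGL_mul (hτ : IsCartanInvolution τ)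
    (g : LinearMap.GeneralLinearGroup ℝ 𝔤) : toGL τ * (toGL τ * g) = g := by
  rw [← mul_assoc, hτ.toGL_mul_self, one_mul]

theorem exists_toGL_eq (hg : g ∈ autCentralizer C) : ∃ φ : 𝔤 ≃ₗ⁅ℝ⁆ 𝔤, toGL φ = g :=
  ⟨{ LinearMap.GeneralLinearGroup.generalLinearEquiv ℝ 𝔤 g with map_lie' := hg.1 _ _ },
    Units.ext rfl⟩

/-- The transform `τ g⁻¹ τ⁻¹` of `g`. For a Cartan involution `τ` and an automorphism `g` of `𝔤`, it
is the adjoint of `g` with respect to `cartanForm τ`. -/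
def cartanAdjoint (τ : 𝔤 ≃ₗ⁅ℝ⁆ 𝔤) (g : LinearMap.GeneralLinearGroup ℝ 𝔤) :
    LinearMap.GeneralLinearGroup ℝ 𝔤 :=
  toGL τ * g⁻¹ * (toGL τ)⁻¹

theorem IsCartanInvolution.cartanForm_cartanAdjoint (hτ : IsCartanInvolution τ)
    (hg : g ∈ autCentralizer C) (x y : 𝔤) :
    cartanForm τ ((cartanAdjoint τ g : Module.End ℝ 𝔤) x) y =
      cartanForm τ x ((g : Module.End ℝ 𝔤) y) := by
  obtain ⟨φ, rfl⟩ := exists_toGL_eq hg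
  rw [cartanAdjoint, hτ.inv_toGL]
  change -killingForm ℝ 𝔤 (τ (φ.symm (τ x))) (τ y) = -killingForm ℝ 𝔤 x (τ (φ y))
  rw [LieAlgebra.killingForm_of_equiv_apply τ, ← LieAlgebra.killingForm_of_equiv_apply φ,
    LieEquiv.apply_symm_apply, ← LieAlgebra.killingForm_of_equiv_apply τ, hτ.involutive]

theorem IsCartanInvolution.cartanAdjoint_mem (hτ : IsCartanInvolution τ)
    (hC : ∀ c ∈ C, (toGL τ : Module.End ℝ 𝔤) * c * toGL τ ∈ C) (hg : g ∈ autCentralizer C) :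
    cartanAdjoint τ g ∈ autCentralizer C := by
  have hsq : (toGL τ : Module.End ℝ 𝔤) * toGL τ = 1 := congrArg Units.val hτ.toGL_mul_self
  have hsq' (S : Module.End ℝ 𝔤) : (toGL τ : Module.End ℝ 𝔤) * (toGL τ * S) = S := by
    rw [← mul_assoc, hsq, one_mul]
  obtain ⟨hlie, hcomm⟩ := inv_mem hg
  rw [cartanAdjoint, hτ.inv_toGL]
  refine ⟨fun x y => ?_, fun c hc => ?_⟩
  · simp only [Units.val_mul, Module.End.mul_apply, toGL_apply, LieEquiv.map_lie, hlie]
  · have h := congrArg (fun S => (toGL τ : Module.End ℝ 𝔤) * S * toGL τ) (hcomm _ (hC c hc)).eq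
    simpa only [mul_assoc, hsq, hsq', mul_one, Commute, SemiconjBy, Units.val_mul] using h

variable [FiniteDimensional ℝ 𝔤]

theorem toGL_mul_expAd (φ : 𝔤 ≃ₗ⁅ℝ⁆ 𝔤) (x : 𝔤) : toGL φ * expAd x = expAd (φ x) * toGL φ := by
  refine Units.ext (expEnd_comp_of_comp_eq (LinearMap.ext fun y => ?_)).symm
  exact (LieEquiv.map_lie φ x y).symm

theorem cartanAdjoint_expAd (x : 𝔤) : cartanAdjoint τ (expAd x) = expAd (-τ x) := by
  rw [cartanAdjoint, ← expAd_neg, toGL_mul_expAd, mul_inv_cancel_right, map_neg]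

theorem IsCartanInvolution.isSelfAdjoint_expAd (hτ : IsCartanInvolution τ) (hp : τ p = -p) :
    (cartanForm τ).IsSelfAdjoint (expAd p : Module.End ℝ 𝔤) := fun x y => by
  have hmem : expAd p ∈ autCentralizer ∅ := expAd_mem_autCentralizer fun c hc => hc.elim
  rw [← hτ.cartanForm_cartanAdjoint hmem, cartanAdjoint_expAd, hp, neg_neg]

theorem expAd_half_mul_self (x : 𝔤) : expAd ((2⁻¹ : ℝ) • x) * expAd ((2⁻¹ : ℝ) • x) = expAd x := by
  rw [← expAd_add_of_lie_eq_zero (lie_self _), ← add_smul, ← two_mul,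
    mul_inv_cancel₀ two_ne_zero, one_smul]

theorem IsCartanInvolution.cartanForm_expAd_nonneg (hτ : IsCartanInvolution τ) (hp : τ p = -p)
    (x : 𝔤) : 0 ≤ cartanForm τ ((expAd p : Module.End ℝ 𝔤) x) x := by
  have hp' : τ ((2⁻¹ : ℝ) • p) = -((2⁻¹ : ℝ) • p) := by rw [map_smul, hp, smul_neg]
  rw [← expAd_half_mul_self, Units.val_mul, Module.End.mul_apply, hτ.isSelfAdjoint_expAd hp']
  exact hτ.cartanForm_nonneg _

theorem IsCartanInvolution.eq_zero_of_expAd_eq_one (hτ : IsCartanInvolution τ) (hp : τ p = -p)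
    (h : expAd p = 1) : p = 0 := by
  have := hτ.isKilling
  refine LieModule.ext_of_isFaithful (R := ℝ) 𝔤 fun x => ?_
  obtain ⟨u, d, -, hd⟩ := exists_orthonormal_eigenbasis hτ.isSymm_cartanForm hτ.cartanForm_pos
    (isSelfAdjoint_ad_of_map_eq_neg hp)
  have hx : expEnd (LieAlgebra.ad ℝ 𝔤 p) x = Real.exp 0 • x := by
    rw [← val_expAd, h, Real.exp_zero, one_smul, Units.val_one, Module.End.one_apply]
  rw [← LieAlgebra.ad_apply ℝ, apply_eq_smul_of_expEnd_apply hd hx, zero_smul, zero_lie]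

theorem IsCartanInvolution.exists_expAd_mul_self_eq (hτ : IsCartanInvolution τ)
    (hC : ∀ c ∈ C, (toGL τ : Module.End ℝ 𝔤) * c * toGL τ ∈ C) (hg : g ∈ autCentralizer C) :
    ∃ p ∈ lieCentralizer C, τ p = -p ∧ expAd p * expAd p = cartanAdjoint τ g * g := by
  have := hτ.isKilling
  have hmem := mul_mem (hτ.cartanAdjoint_mem hC hg) hg
  have hform (x y : 𝔤) : cartanForm τ ((cartanAdjoint τ g * g).1 x) y =
      cartanForm τ (g.1 x) (g.1 y) := hτ.cartanForm_cartanAdjoint hg _ y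
  have hinj : Function.Injective g.1 :=
    (LinearMap.GeneralLinearGroup.generalLinearEquiv ℝ 𝔤 g).injective
  obtain ⟨u, d, D, hD, hexp⟩ := exists_eq_expEnd_of_form_pos hτ.isSymm_cartanForm hτ.cartanForm_pos
    (fun x y => by rw [hform, hτ.cartanForm_comm x, hform, hτ.cartanForm_comm (g.1 x)])
    (fun x hx => by
      rw [hform]
      exact hτ.cartanForm_pos _ ((map_ne_zero_iff _ hinj).mpr hx))
  obtain ⟨z, hz, rfl⟩ := exists_mem_lieCentralizer_expAd_eq hmem hD hexp
  have hz' : expAd z = cartanAdjoint τ g * g := Units.ext hexp.symm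
  have hτz : τ z = -z := by
    have hD' (i) : LieAlgebra.ad ℝ 𝔤 (-z) (u i) = (-d i) • u i := by
      rw [map_neg, LinearMap.neg_apply, hD, neg_smul]
    have hconj : toGL τ * expAd z = expAd (-z) * toGL τ := by
      simp only [expAd_neg, hz', cartanAdjoint, hτ.inv_toGL, mul_inv_rev, inv_inv, mul_assoc,
        hτ.toGL_mul_self, hτ.toGL_mul_toGL_mul, mul_one]
    have hlie := comp_eq_of_expEnd_comp_eq hD hD' (congrArg Units.val hconj).symm
    refine LieModule.ext_of_isFaithful (R := ℝ) 𝔤 fun x => ?_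
    obtain ⟨x, rfl⟩ := τ.surjective x
    exact (LieEquiv.map_lie τ z x).symm.trans (LinearMap.congr_fun hlie x).symm
  exact ⟨(2⁻¹ : ℝ) • z, (lieCentralizer C).smul_mem _ hz, by rw [map_smul, hτz, smul_neg],
    by rw [expAd_half_mul_self, hz']⟩

theorem IsCartanInvolution.mul_expAd_neg_mem (hτ : IsCartanInvolution τ)
    (hg : g ∈ autCentralizer C) (hpC : p ∈ lieCentralizer C) (hp : τ p = -p)
    (h : expAd p * expAd p = cartanAdjoint τ g * g) :
    g * expAd (-p) ∈ autCentralizer (insert (toGL τ : Module.End ℝ 𝔤) C) := by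
  have hcomm : Commute (g * expAd (-p)) (toGL τ) := by
    calc g * expAd (-p) * toGL τ = g * (toGL τ * expAd p) := by
          rw [toGL_mul_expAd, hp, mul_assoc]
      _ = g * (toGL τ * (expAd p * expAd p * expAd (-p))) := by
          rw [expAd_neg, mul_inv_cancel_right]
      _ = toGL τ * (g * expAd (-p)) := by
          simp only [h, cartanAdjoint, hτ.inv_toGL, mul_assoc, hτ.toGL_mul_toGL_mul,
            mul_inv_cancel_left]
  exact mem_autCentralizer_insert_iff.mpr
    ⟨hcomm.units_val, mul_mem hg (expAd_mem_autCentralizer (neg_mem hpC))⟩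

attribute [local instance] endNormedRing endNormedAlgebra

theorem IsCartanInvolution.continuous_expAd_of_continuous_mul_self (hτ : IsCartanInvolution τ)
    {X : Type*} [TopologicalSpace X] {f : X → 𝔤} (hf : ∀ x, τ (f x) = -f x)
    (hcont : Continuous fun x => expAd (f x) * expAd (f x)) :
    Continuous fun x => expAd (f x) := by
  have hval {q : X → 𝔤} (hq : ∀ x, τ (q x) = -q x)
      (hcont : Continuous fun x => expAd (q x) * expAd (q x)) :
      Continuous fun x => (expAd (q x) : Module.End ℝ 𝔤) :=
    continuous_of_continuous_mul_self hτ.isSymm_cartanForm hτ.cartanForm_pos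
      (fun x => hτ.isSelfAdjoint_expAd (hq x)) (fun x => hτ.cartanForm_expAd_nonneg (hq x))
      (Units.continuous_val.comp hcont)
  refine Units.continuous_iff.mpr ⟨hval hf hcont, ?_⟩
  simp only [← expAd_neg]
  exact hval (fun x => by rw [map_neg, hf]) (hcont.inv.congr fun x => by
    rw [Pi.inv_apply, mul_inv_rev, expAd_neg])

theorem IsCartanInvolution.exists_mul_expAd_neg_mem_adGroup (hτ : IsCartanInvolution τ)
    (hC : ∀ c ∈ C, (toGL τ : Module.End ℝ 𝔤) * c * toGL τ ∈ C)
    (hg : g ∈ adGroup (lieCentralizer C)) :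
    ∃ p, τ p = -p ∧
      g * expAd (-p) ∈ adGroup (lieCentralizer (insert (toGL τ : Module.End ℝ 𝔤) C)) := by
  have := hτ.isKilling
  choose! p hpC hp hsq using fun g (hg : g ∈ autCentralizer C) => hτ.exists_expAd_mul_self_eq hC hg
  let κ (g : autCentralizer C) : autCentralizer (insert (toGL τ : Module.End ℝ 𝔤) C) :=
    ⟨g * expAd (-p g), hτ.mul_expAd_neg_mem g.2 (hpC g g.2) (hp g g.2) (hsq g g.2)⟩
  have hκ : Continuous κ := by
    have hval : Continuous fun g : autCentralizer C => g.1 := continuous_subtype_val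
    have hexp := hτ.continuous_expAd_of_continuous_mul_self
      (fun g : autCentralizer C => hp g g.2)
      ((((continuous_const.mul hval.inv).mul continuous_const).mul hval).congr
        fun g => (hsq g g.2).symm)
    exact (hval.mul (hexp.inv.congr fun g => (expAd_neg _).symm)).subtype_mk _
  have hκ1 : κ 1 = 1 := by
    have hexp : expAd (p 1 + p 1) = 1 := by
      rw [expAd_add_of_lie_eq_zero (lie_self _), hsq 1 (one_mem _)]
      simp only [cartanAdjoint, inv_one, mul_one, mul_inv_cancel]
    have hadd : p 1 + p 1 = 0 :=
      hτ.eq_zero_of_expAd_eq_one (by rw [map_add, hp 1 (one_mem _), neg_add]) hexp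
    have hp1 : p 1 = 0 :=
      (smul_eq_zero.mp ((two_smul ℝ (p 1)).trans hadd)).resolve_left two_ne_zero
    refine Subtype.ext ?_
    simp only [κ, OneMemClass.coe_one, hp1, neg_zero, expAd_zero, mul_one]
  rw [adGroup_eq_connectedComponent] at hg ⊢
  obtain ⟨g, hg, rfl⟩ := hg
  have hκg : κ g ∈ connectedComponent 1 :=
    hκ1 ▸ hκ.image_connectedComponent_subset 1 ⟨g, hg, rfl⟩
  exact ⟨p g, hp g g.2, κ g, hκg, rfl⟩

end CartanInvolution

section Conjugacy

variable {𝔤 : Type*} [LieRing 𝔤] [LieAlgebra ℝ 𝔤] {τ : 𝔤 ≃ₗ⁅ℝ⁆ 𝔤}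

theorem cartanForm_lie_self {x : 𝔤} (hx : ⁅x, τ x⁆ = 0) (p : 𝔤) :
    cartanForm τ ⁅p, x⁆ x = 0 := by
  rw [cartanForm_apply, LieModule.traceForm_apply_lie_apply, hx, map_zero, neg_zero]

theorem lie_map_self_of_mem_autCentralizer {C : Set (Module.End ℝ 𝔤)}
    {k : LinearMap.GeneralLinearGroup ℝ 𝔤}
    (hk : k ∈ autCentralizer (insert (toGL τ : Module.End ℝ 𝔤) C)) {x : 𝔤}
    (hx : ⁅x, τ x⁆ = 0) : ⁅(k : Module.End ℝ 𝔤) x, τ ((k : Module.End ℝ 𝔤) x)⁆ = 0 := by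
  obtain ⟨hτk, hlie, -⟩ := mem_autCentralizer_insert_iff.mp hk
  have hcomm : τ ((k : Module.End ℝ 𝔤) x) = (k : Module.End ℝ 𝔤) (τ x) :=
    (LinearMap.congr_fun hτk.eq x).symm
  rw [hcomm, ← hlie, hx, map_zero]

theorem IsCartanInvolution.adConj_insert [FiniteDimensional ℝ 𝔤] (hτ : IsCartanInvolution τ)
    {C : Set (Module.End ℝ 𝔤)} (hC : ∀ c ∈ C, (toGL τ : Module.End ℝ 𝔤) * c * toGL τ ∈ C)
    {h h' : 𝔤} (hh : ⁅h, τ h⁆ = 0) (hh' : ⁅h', τ h'⁆ = 0)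
    (hconj : AdConj (lieCentralizer C) h h') :
    AdConj (lieCentralizer (insert (toGL τ : Module.End ℝ 𝔤) C)) h h' := by
  obtain ⟨g, hg, rfl⟩ := hconj
  obtain ⟨p, hp, hk⟩ := hτ.exists_mul_expAd_neg_mem_adGroup hC hg
  set k := g * expAd (-p) with hkg
  have hexp : (expAd p : Module.End ℝ 𝔤) h =
      (k⁻¹ : LinearMap.GeneralLinearGroup ℝ 𝔤).1 ((g : Module.End ℝ 𝔤) h) := by
    have hmul : expAd p = k⁻¹ * g := by
      rw [hkg, expAd_neg, mul_inv_rev, inv_inv, inv_mul_cancel_right]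
    rw [hmul, Units.val_mul, Module.End.mul_apply]
  have hw : ⁅(expAd p : Module.End ℝ 𝔤) h, τ ((expAd p : Module.End ℝ 𝔤) h)⁆ = 0 :=
    hexp ▸ lie_map_self_of_mem_autCentralizer (inv_mem (adGroup_le_autCentralizer hk)) hh'
  have hfix : (expAd p : Module.End ℝ 𝔤) h = h :=
    expEnd_apply_eq_self_of_form_eq hτ.isSymm_cartanForm hτ.cartanForm_pos
      (isSelfAdjoint_ad_of_map_eq_neg hp)
      ((cartanForm_lie_self hw p).trans (cartanForm_lie_self hh p).symm)
  refine ⟨k, hk, ?_⟩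
  calc (k : Module.End ℝ 𝔤) h = (k : Module.End ℝ 𝔤) ((expAd p : Module.End ℝ 𝔤) h) := by rw [hfix]
    _ = ((k * expAd p : LinearMap.GeneralLinearGroup ℝ 𝔤) : Module.End ℝ 𝔤) h := rfl
    _ = (g : Module.End ℝ 𝔤) h := by rw [hkg, expAd_neg, inv_mul_cancel_right]

end Conjugacy

section HomogeneousProjection

variable {ι R M : Type*} [DecidableEq ι] [Semiring R] [AddCommMonoid M] [Module R M]
  (ℳ : ι → Submodule R M) [DirectSum.Decomposition ℳ]

/-- The projection of a graded module onto its homogeneous component of degree `i`, as an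
endomorphism. -/
def homogeneousProj (i : ι) : Module.End R M :=
  (ℳ i).subtype ∘ₗ DirectSum.component R ι (fun i => ℳ i) i ∘ₗ
    (DirectSum.decomposeLinearEquiv ℳ : M →ₗ[R] _)

variable {ℳ}

theorem homogeneousProj_mem (i : ι) (x : M) : homogeneousProj ℳ i x ∈ ℳ i :=
  SetLike.coe_mem _

theorem homogeneousProj_of_mem {i : ι} {x : M} (hx : x ∈ ℳ i) : homogeneousProj ℳ i x = x :=
  DirectSum.decompose_of_mem_same ℳ hx

theorem homogeneousProj_of_mem_ne {i j : ι} {x : M} (hx : x ∈ ℳ i) (hij : i ≠ j) :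
    homogeneousProj ℳ j x = 0 :=
  DirectSum.decompose_of_mem_ne ℳ hx hij

theorem mul_homogeneousProj {T : Module.End R M} {σ : ι → ι} (hσ : Function.Injective σ)
    (hT : ∀ i, ∀ x ∈ ℳ i, T x ∈ ℳ (σ i)) (i : ι) :
    T * homogeneousProj ℳ i = homogeneousProj ℳ (σ i) * T := by
  refine DirectSum.decompose_lhom_ext ℳ fun j => LinearMap.ext fun x => ?_
  change T (homogeneousProj ℳ i x) = homogeneousProj ℳ (σ i) (T x)
  rcases eq_or_ne j i with rfl | hji
  · rw [homogeneousProj_of_mem x.2, homogeneousProj_of_mem (hT j x x.2)]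
  · rw [homogeneousProj_of_mem_ne x.2 hji, map_zero,
      homogeneousProj_of_mem_ne (hT j x x.2) (hσ.ne hji)]

end HomogeneousProjection

section Grading

variable {𝔤 : Type*} [LieRing 𝔤] [LieAlgebra ℝ 𝔤] {m : ℕ} {𝒢 : ZMod m → Submodule ℝ 𝔤}
  [GradedLieAlgebra 𝒢] {τ : 𝔤 ≃ₗ⁅ℝ⁆ 𝔤}

theorem ad_mul_homogeneousProj {i : ZMod m} {x : 𝔤} (hx : x ∈ 𝒢 i) (j : ZMod m) :
    LieAlgebra.ad ℝ 𝔤 x * homogeneousProj 𝒢 j =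
      homogeneousProj 𝒢 (i + j) * LieAlgebra.ad ℝ 𝔤 x :=
  mul_homogeneousProj (σ := (i + ·)) (add_right_injective i)
    (fun _ _ hy => SetLike.GradedBracket.bracket_mem hx hy) j

theorem lieCentralizer_range_homogeneousProj [LieModule.IsFaithful ℝ 𝔤 𝔤] :
    lieCentralizer (Set.range (homogeneousProj 𝒢)) = zeroPart 𝒢 := by
  refine le_antisymm (fun x hx => ?_) fun x hx => ?_
  · have had (y : 𝔤) : ⁅x, y⁆ = ⁅homogeneousProj 𝒢 0 x, y⁆ := by
      suffices LieAlgebra.ad ℝ 𝔤 x = LieAlgebra.ad ℝ 𝔤 (homogeneousProj 𝒢 0 x) from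
        LinearMap.congr_fun this y
      refine DirectSum.decompose_lhom_ext 𝒢 fun i => LinearMap.ext fun y => ?_
      calc ⁅x, (y : 𝔤)⁆ = ⁅x, homogeneousProj 𝒢 i y⁆ := by rw [homogeneousProj_of_mem y.2]
        _ = homogeneousProj 𝒢 i ⁅x, (y : 𝔤)⁆ := LinearMap.congr_fun (hx _ ⟨i, rfl⟩).eq y
        _ = -homogeneousProj 𝒢 (i + 0) ⁅(y : 𝔤), x⁆ := by rw [add_zero, ← lie_skew, map_neg]
        _ = -⁅(y : 𝔤), homogeneousProj 𝒢 0 x⁆ :=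
          congrArg Neg.neg (LinearMap.congr_fun (ad_mul_homogeneousProj y.2 0) x).symm
        _ = ⁅homogeneousProj 𝒢 0 x, (y : 𝔤)⁆ := lie_skew _ _
    rw [LieModule.ext_of_isFaithful (R := ℝ) 𝔤 had]
    exact homogeneousProj_mem 0 x
  · rintro - ⟨i, rfl⟩
    have h := ad_mul_homogeneousProj (𝒢 := 𝒢) hx i
    rwa [zero_add] at h

theorem lieCentralizer_insert_toGL [LieModule.IsFaithful ℝ 𝔤 𝔤] (τ : 𝔤 ≃ₗ⁅ℝ⁆ 𝔤)
    (C : Set (Module.End ℝ 𝔤)) :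
    lieCentralizer (insert (toGL τ : Module.End ℝ 𝔤) C) = lieCentralizer C ⊓ fixedPart τ := by
  have hcomm (x : 𝔤) :
      Commute (LieAlgebra.ad ℝ 𝔤 x) (toGL τ : Module.End ℝ 𝔤) ↔ τ x = x := by
    refine ⟨fun h => LieModule.ext_of_isFaithful (R := ℝ) 𝔤 fun y => ?_,
      fun h => LinearMap.ext fun y => ?_⟩
    · obtain ⟨y, rfl⟩ := τ.surjective y
      exact (LieEquiv.map_lie τ x y).symm.trans (LinearMap.congr_fun h.eq y).symm
    · change ⁅x, τ y⁆ = τ ⁅x, y⁆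
      rw [LieEquiv.map_lie, h]
  refine LieSubalgebra.ext _ _ fun x => ?_
  calc x ∈ lieCentralizer (insert (toGL τ : Module.End ℝ 𝔤) C)
      ↔ Commute (LieAlgebra.ad ℝ 𝔤 x) (toGL τ : Module.End ℝ 𝔤) ∧ x ∈ lieCentralizer C :=
        Set.forall_mem_insert
    _ ↔ x ∈ lieCentralizer C ⊓ fixedPart τ := by rw [hcomm, and_comm]; rfl

theorem IsRCompatible.toGL_mul_mem_range_homogeneousProj (hτ𝒢 : IsRCompatible 𝒢 τ)
    (hτ : IsCartanInvolution τ) {c : Module.End ℝ 𝔤} (hc : c ∈ Set.range (homogeneousProj 𝒢)) :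
    (toGL τ : Module.End ℝ 𝔤) * c * toGL τ ∈ Set.range (homogeneousProj 𝒢) := by
  obtain ⟨i, rfl⟩ := hc
  have hmap : ∀ i, ∀ x ∈ 𝒢 i, (toGL τ : Module.End ℝ 𝔤) x ∈ 𝒢 (-i) :=
    fun i x hx => hτ𝒢 i ▸ Submodule.mem_map_of_mem hx
  have hsq : (toGL τ : Module.End ℝ 𝔤) * toGL τ = 1 := congrArg Units.val hτ.toGL_mul_self
  exact ⟨-i, by rw [mul_homogeneousProj neg_injective hmap, mul_assoc, hsq, mul_one]⟩

end Grading

end GradedLie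

end

theorem proposition5_general {𝔤 : Type*} [LieRing 𝔤] [LieAlgebra ℝ 𝔤] [FiniteDimensional ℝ 𝔤]
    {m : ℕ} (𝒢 : ZMod m → Submodule ℝ 𝔤) [GradedLieAlgebra 𝒢]
    (τ : 𝔤 ≃ₗ⁅ℝ⁆ 𝔤) (hτ : GradedLie.IsCartanInvolution τ) (hτ𝒢 : GradedLie.IsRCompatible 𝒢 τ)
    (h h' : 𝔤) (hh : ⁅h, τ h⁆ = 0) (hh' : ⁅h', τ h'⁆ = 0)
    (hconj : GradedLie.AdConj (GradedLie.zeroPart 𝒢) h h') :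
    GradedLie.AdConj (GradedLie.zeroPart 𝒢 ⊓ GradedLie.fixedPart τ) h h' := by
  have := hτ.isKilling
  rw [← GradedLie.lieCentralizer_range_homogeneousProj] at hconj ⊢
  rw [← GradedLie.lieCentralizer_insert_toGL]
  exact hτ.adConj_insert (fun _ hc => hτ𝒢.toGL_mul_mem_range_homogeneousProj hτ hc) hh hh' hconj

theorem proposition5 {𝔤 : Type*} [LieRing 𝔤] [LieAlgebra ℝ 𝔤] [FiniteDimensional ℝ 𝔤]
    [LieAlgebra.IsSemisimple ℝ 𝔤]
    (𝒢 : ZMod 2 → Submodule ℝ 𝔤) [GradedLieAlgebra 𝒢]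
    (τ : 𝔤 ≃ₗ⁅ℝ⁆ 𝔤) (hτ : GradedLie.IsCartanInvolution τ) (hτ𝒢 : GradedLie.IsRCompatible 𝒢 τ)
    (𝔥 : Submodule ℝ 𝔤) (h𝔥 : GradedLie.IsStandardCartanSubspace 𝒢 τ 𝔥)
    (h h' : 𝔤) (hh : h ∈ 𝔥) (hh' : h' ∈ 𝔥)
    (hconj : GradedLie.AdConj (GradedLie.zeroPart 𝒢) h h') :
    GradedLie.AdConj (GradedLie.zeroPart 𝒢 ⊓ GradedLie.fixedPart τ) h h' := by
  have hlie (x : 𝔤) (hx : x ∈ 𝔥) : ⁅x, τ x⁆ = 0 := h𝔥.1.prop.2.2 x hx _ (h𝔥.2 x hx)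
  exact proposition5_general 𝒢 τ hτ hτ𝒢 h h' (hlie h hh) (hlie h' hh') hconj
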